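/- Let $0<r<n$, $J=I_r\oplus -I_{n-r}$, let $\alpha\neq\beta$ be real numbers, $C$ a complex $r\times(n-r)$ matrix, and suppose that $$A=\begin{bmatrix}\alpha I_r & C\\ C^* & \beta I_{n-r}\end{bmatrix}$$ is not diagonal. Put $[x,y]_J=y^*Jx$ and let $$W^J(A)=\{[Ax,x]_J : [x,x]_J=1\}\cup\{-[Ax,x]_J : [x,x]_J=-1\}$$ be the Krein space numerical range of $A$. Let $A^\#=JA^*J$, $\Re^J(A)=\frac12(A+A^\#)$, $\Im^J(A)=\frac1{2i}(A-A^\#)$, and let the indefinite Kippenhahn curve $C^J(A)$ be the real part (in $\mathbb R^2\cong\mathbb C$) of the algebraic curve whose equation in homogeneous line coordinates $(u:v:w)$ (representing the line $ux+vy+w=0$) is $\det(u\,\Re^J(A)+v\,\Im^J(A)+w I_n)=0$; its components are the real parts of the dual curves of the irreducible factors of this determinant, the dual of a linear factor being a point. Let $\sigma_1>\cdots>\sigma_s$ be the distinct nonzero singular values of $C$ and $\omega=\frac12(\alpha-\beta)$. For $j=1,\dots,s$ let $\tilde H_j$ be the hyperbola centered at $\frac12(\alpha+\beta)$ with horizontal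 transverse semi-axis of length $|\omega|$ and vertical non-transverse semi-axis of length $\sigma_j$. Then $s\ge 1$ and: 1. $\tilde H_1,\dots,\tilde H_s$ are non-degenerate, pairwise distinct and nested: for $i<j$ the closed hyperbolic disc bounded by $\tilde H_j$ is strictly contained in the one bounded by $\tilde H_i$. 2. The components of $C^J(A)$ are exactly $\tilde H_1,\dots,\tilde H_s$ and, additionally: both points $\alpha$ and $\beta$, if $C$ is not of full rank, i.e. $\operatorname{rank}C\ne\min\{r,n-r\}$; the point $\alpha$, if $n<2r$; the point $\beta$, if $n>2r$. The set $C^J(A)$ is the union of these components. 3. $W^J(A)$ is the closed, non-degenerate hyperbolic disc bounded by the outermost hyperbola $\tilde H_1$, i.e. the set of all $x+iy$ with $\dfrac{(x-\frac{\alpha+\beta}2)^2}{|\omega|^2}-\dfrac{y^2}{\sigma_1^2}\ge 1$, and its boundary is $\tilde H_1$. -/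

import Mathlib

noncomputable section

namespace KreinRange

/-- The signature matrix `J = I_r ⊕ -I_{n-r}`. -/
def signatureJ (r n : ℕ) : Matrix (Fin r ⊕ Fin (n - r)) (Fin r ⊕ Fin (n - r)) ℂ :=
  Matrix.fromBlocks 1 0 0 (-1)

/-- The block matrix with diagonal blocks `α I_r`, `β I_{n-r}` and off-diagonal blocks `C`, `D`. -/
def blockMatrix {r n : ℕ} (α β : ℂ) (C : Matrix (Fin r) (Fin (n - r)) ℂ)
    (D : Matrix (Fin (n - r)) (Fin r) ℂ) :
    Matrix (Fin r ⊕ Fin (n - r)) (Fin r ⊕ Fin (n - r)) ℂ :=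
  Matrix.fromBlocks (α • (1 : Matrix (Fin r) (Fin r) ℂ)) C D
    (β • (1 : Matrix (Fin (n - r)) (Fin (n - r)) ℂ))

section General

variable {ι : Type*} [Fintype ι] [DecidableEq ι]

/-- The indefinite inner product `[x, y]_J = y* J x`. -/
def indefInner (J : Matrix ι ι ℂ) (x y : ι → ℂ) : ℂ :=
  star y ⬝ᵥ J.mulVec x

/-- `W_+^J(A) = {[Ax, x]_J : [x, x]_J = 1}`. -/
def rangePlus (J A : Matrix ι ι ℂ) : Set ℂ :=
  {z | ∃ x : ι → ℂ, indefInner J x x = 1 ∧ z = indefInner J (A.mulVec x) x}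

/-- `W_-^J(A) = {[Ax, x]_J : [x, x]_J = -1}`. -/
def rangeMinus (J A : Matrix ι ι ℂ) : Set ℂ :=
  {z | ∃ x : ι → ℂ, indefInner J x x = -1 ∧ z = indefInner J (A.mulVec x) x}

/-- The Krein space numerical range `W^J(A) = -W_-^J(A) ∪ W_+^J(A)`. -/
def kreinRange (J A : Matrix ι ι ℂ) : Set ℂ :=
  {z | -z ∈ rangeMinus J A} ∪ rangePlus J A

/-- The `J`-adjoint `A^# = J A* J` (for a signature matrix `J`). -/
def jAdjoint (J A : Matrix ι ι ℂ) : Matrix ι ι ℂ :=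
  J * A.conjTranspose * J

/-- `Re^J(A) = (A + A^#) / 2`. -/
def jRe (J A : Matrix ι ι ℂ) : Matrix ι ι ℂ :=
  (1 / 2 : ℂ) • (A + jAdjoint J A)

/-- `Im^J(A) = (A - A^#) / (2i)`. -/
def jIm (J A : Matrix ι ι ℂ) : Matrix ι ι ℂ :=
  (1 / (2 * Complex.I) : ℂ) • (A - jAdjoint J A)

/-- The form `det (u Re^J(A) + v Im^J(A) + w I)`, where `u, v, w` are the variables with indices
`0, 1, 2`; they are homogeneous coordinates of the line `u x + v y + w = 0`. -/
def linePoly (J A : Matrix ι ι ℂ) : MvPolynomial (Fin 3) ℂ :=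
  Matrix.det
    ((MvPolynomial.X 0 : MvPolynomial (Fin 3) ℂ) • (jRe J A).map MvPolynomial.C
      + (MvPolynomial.X 1 : MvPolynomial (Fin 3) ℂ) • (jIm J A).map MvPolynomial.C
      + (MvPolynomial.X 2 : MvPolynomial (Fin 3) ℂ) • (1 : Matrix ι ι (MvPolynomial (Fin 3) ℂ)))

end General

/-- For an irreducible form `p` in line coordinates, the affine part (in `ℂ²`) of the curve whose
tangent lines are the zeros of `p`, that is, of the dual curve of `p = 0`. The lines near a
nonsingular zero `q` of `p` envelop the point with homogeneous coordinates
`(∂₀p(q) : ∂₁p(q) : ∂₂p(q))`; the dual curve is the closure of the set of these points (for this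
constructible set the Euclidean and the Zariski closure agree). If `p` is linear, the dual is a
single point, the centre of a pencil of lines. -/
def dualCurve (p : MvPolynomial (Fin 3) ℂ) : Set (ℂ × ℂ) :=
  closure {P | ∃ q : Fin 3 → ℂ, q ≠ 0 ∧ MvPolynomial.eval q p = 0 ∧
    MvPolynomial.eval q (MvPolynomial.pderiv 2 p) ≠ 0 ∧
    P = (MvPolynomial.eval q (MvPolynomial.pderiv 0 p) /
          MvPolynomial.eval q (MvPolynomial.pderiv 2 p),
        MvPolynomial.eval q (MvPolynomial.pderiv 1 p) /
          MvPolynomial.eval q (MvPolynomial.pderiv 2 p))}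

/-- The real part of the dual curve, as a subset of `ℂ`, the point `(x, y)` being `x + i y`. -/
def realDual (p : MvPolynomial (Fin 3) ℂ) : Set ℂ :=
  {z | ((z.re : ℂ), (z.im : ℂ)) ∈ dualCurve p}

section General

variable {ι : Type*} [Fintype ι] [DecidableEq ι]

/-- The components of the indefinite Kippenhahn curve: the real parts of the duals of the
irreducible components of the curve `det (u Re^J(A) + v Im^J(A) + w I) = 0`. -/
def kippenhahnComponents (J A : Matrix ι ι ℂ) : Set (Set ℂ) :=
  {S | ∃ p : MvPolynomial (Fin 3) ℂ, Irreducible p ∧ p ∣ linePoly J A ∧ S = realDual p}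

/-- The indefinite Kippenhahn curve (indefinite boundary generating curve) `C^J(A)`. -/
def kippenhahnCurve (J A : Matrix ι ι ℂ) : Set ℂ :=
  ⋃₀ kippenhahnComponents J A

end General

/-- The hyperbola with centre `c`, horizontal transverse semi-axis `a` and vertical non-transverse
semi-axis `b`. -/
def hyperbola (c : ℂ) (a b : ℝ) : Set ℂ :=
  {z | (z.re - c.re) ^ 2 / a ^ 2 - (z.im - c.im) ^ 2 / b ^ 2 = 1}

/-- The hyperbolic disc bounded by that hyperbola: the two closed convex regions bounded by its
branches (those that contain the foci). -/
def hyperbolicDisc (c : ℂ) (a b : ℝ) : Set ℂ :=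
  {z | 1 ≤ (z.re - c.re) ^ 2 / a ^ 2 - (z.im - c.im) ^ 2 / b ^ 2}

/-- The set of nonzero singular values of a complex matrix. -/
def nonzeroSingularValues {m k : ℕ} (C : Matrix (Fin m) (Fin k) ℂ) : Set ℝ :=
  {t | t ≠ 0 ∧ ∃ i : ℕ, (Matrix.toEuclideanLin C).singularValues i = t}

end KreinRange

end

/-!
The theorem rests on two computations with the block structure of `A`.

*Kippenhahn curve.* Since `Re^J(A) = α I ⊕ β I` and `Im^J(A)` is off-diagonal with blocks `-i C` and
`-i C*`, a Schur complement gives, with `a = α u + w`, `b = β u + w` and `k = rank C`,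
`det (u Re^J(A) + v Im^J(A) + w I) = a ^ (r - k) * b ^ (n - r - k) * ∏ (a b + σ² v²)`,
the product running over the nonzero singular values `σ` of `C` with multiplicity
(`KreinRange.linePoly_eq`). In the line coordinates `a, b, v`, which are independent because `α ≠ β`,
each quadratic factor is visibly irreducible (`KreinRange.irreducible_conicForm`), so these are all
the irreducible factors up to associates. The dual of `a` is the point `α`, the dual of `b` is the
point `β`, and the dual of `a b + σ² v²` is the hyperbola with semi-axes `|α - β| / 2` and `σ`
(`KreinRange.realDual_conicForm`). The factor `a` occurs if and only if `k < r`, and `b` if and only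
if `k < n - r`; as `k ≤ min r (n - r)`, these are the stated conditions.

*Numerical range.* For `x = (ξ, η)` one has `[x, x]_J = ‖ξ‖² - ‖η‖²` and
`[A x, x]_J = α ‖ξ‖² - β ‖η‖² + 2 i Im ⟪ξ, C η⟫`. On `[x, x]_J = ±1` the real part depends only on
the norms, whereas `Im ⟪ξ, C η⟫` takes exactly the values in `[-σ₁ ‖ξ‖ ‖η‖, σ₁ ‖ξ‖ ‖η‖]` when the
norms are fixed: the bound is the operator norm (`LinearMap.norm_apply_le_singularValues_zero`), and
the phase of a pair of leading singular vectors is free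
(`KreinRange.exists_im_inner_toEuclideanLin_eq`). Eliminating the norms gives the hyperbolic disc
(`KreinRange.kreinRange_blockMatrix`).
-/

/-! ### The determinant of the line pencil -/

section

open MvPolynomial KreinRange
open scoped Matrix ComplexOrder InnerProductSpace

/-- Schur complement formula for scalar diagonal blocks. Multiplying by a power of `a` avoids
inverting `a`, so that it applies over a polynomial ring. -/
theorem Matrix.det_fromBlocks_smul_one_mul_pow {m k R : Type*} [Fintype m] [DecidableEq m]
    [Fintype k] [DecidableEq k] [CommRing R] (a b : R) (X : Matrix m k R) (Y : Matrix k m R) :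
    (Matrix.fromBlocks (a • 1) X Y (b • 1)).det * a ^ Fintype.card k
      = a ^ Fintype.card m * ((a * b) • (1 : Matrix k k R) - Y * X).det := by
  have h : Matrix.fromBlocks (a • 1) X Y (b • 1) * Matrix.fromBlocks 1 (-X) 0 (a • 1)
      = Matrix.fromBlocks (a • (1 : Matrix m m R)) 0 Y ((a * b) • 1 - Y * X) := by
    rw [Matrix.fromBlocks_multiply]
    congr 1 <;> simp [mul_smul, sub_eq_add_neg, add_comm, smul_comm a b]
  have h2 := congrArg Matrix.det h
  rw [Matrix.det_mul, Matrix.det_fromBlocks_zero₂₁, Matrix.det_fromBlocks_zero₁₂] at h2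
  simpa [Matrix.det_smul] using h2

theorem Matrix.IsHermitian.det_smul_one_add_smul_map {k τ : Type*} [Fintype k] [DecidableEq k]
    {M : Matrix k k ℂ} (hM : M.IsHermitian) (P Q : MvPolynomial τ ℂ) :
    (P • (1 : Matrix k k (MvPolynomial τ ℂ)) + Q • M.map C).det
      = ∏ j, (P + C (hM.eigenvalues j : ℂ) * Q) := by
  set U : Matrix k k ℂ := (hM.eigenvectorUnitary : Matrix k k ℂ)
  have hUU : U * star U = 1 := Unitary.coe_mul_star_self hM.eigenvectorUnitary
  set V : Matrix k k (MvPolynomial τ ℂ) := U.map C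
  set V' : Matrix k k (MvPolynomial τ ℂ) := (star U).map C
  have hVV : V * V' = 1 := by
    rw [← Matrix.map_mul, hUU]
    exact Matrix.map_one _ C_0 C_1
  have hsp : M = U * Matrix.diagonal (fun j => (hM.eigenvalues j : ℂ)) * star U := by
    have := hM.spectral_theorem
    rwa [Unitary.conjStarAlgAut_apply] at this
  have hMap : M.map C = V * Matrix.diagonal (fun j => C (hM.eigenvalues j : ℂ)) * V' := by
    conv_lhs => rw [hsp]
    rw [Matrix.map_mul, Matrix.map_mul, Matrix.diagonal_map (by simp)]
  have key : P • (1 : Matrix k k (MvPolynomial τ ℂ)) + Q • M.map C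
      = V * Matrix.diagonal (fun j => P + C (hM.eigenvalues j : ℂ) * Q) * V' := by
    have hd : Matrix.diagonal (fun j => P + C (hM.eigenvalues j : ℂ) * Q)
        = P • (1 : Matrix k k (MvPolynomial τ ℂ))
          + Q • Matrix.diagonal (fun j => C (hM.eigenvalues j : ℂ)) := by
      ext i j
      by_cases h : i = j
      · subst h; simp [mul_comm]
      · simp [h]
    rw [hd, hMap, mul_add, add_mul]
    simp [hVV]
  rw [key, Matrix.det_mul, Matrix.det_mul, Matrix.det_diagonal, mul_right_comm, ← Matrix.det_mul,
    hVV, Matrix.det_one, one_mul]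

namespace KreinRange

/-- The linear form of the lines through the real point `t`. -/
noncomputable def pencilForm (t : ℝ) : MvPolynomial (Fin 3) ℂ := C (t : ℂ) * X 0 + X 2

/-- The quadratic form of the tangent lines to the hyperbola with vertices `α`, `β` and squared
non-transverse semi-axis `l`. For `l = 0` it degenerates to the two pencils at the vertices. -/
noncomputable def conicForm (α β l : ℝ) : MvPolynomial (Fin 3) ℂ :=
  pencilForm α * pencilForm β + C (l : ℂ) * X 1 ^ 2

/-- Here `Re^J(A) = α I ⊕ β I` and `Im^J(A)` has off-diagonal blocks `-i D` and `-i D*`, so the Schur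
complement only involves the eigenvalues of `D* D`. -/
theorem linePoly_mul_pow {r n : ℕ} (α β : ℝ) (D : Matrix (Fin r) (Fin (n - r)) ℂ) :
    linePoly (signatureJ r n) (blockMatrix (α : ℂ) (β : ℂ) D Dᴴ) * pencilForm α ^ (n - r)
      = pencilForm α ^ r * ∏ j, conicForm α β
        ((Matrix.isHermitian_conjTranspose_mul_self D).eigenvalues j) := by
  set A := blockMatrix (α : ℂ) (β : ℂ) D Dᴴ with hA
  have hadj : jAdjoint (signatureJ r n) A = blockMatrix (α : ℂ) (β : ℂ) (-D) (-Dᴴ) := by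
    simp [jAdjoint, hA, blockMatrix, signatureJ, Matrix.fromBlocks_conjTranspose,
      Matrix.fromBlocks_multiply, Matrix.conjTranspose_smul]
  have hre : jRe (signatureJ r n) A = blockMatrix (α : ℂ) (β : ℂ) 0 0 := by
    rw [jRe, hadj, hA, blockMatrix, blockMatrix, blockMatrix, Matrix.fromBlocks_add,
      Matrix.fromBlocks_smul]
    congr 1
    · rw [← two_smul ℂ, smul_smul]; norm_num
    · simp
    · simp
    · rw [← two_smul ℂ, smul_smul]; norm_num
  have him : jIm (signatureJ r n) A
      = Matrix.fromBlocks 0 (-Complex.I • D) (-Complex.I • Dᴴ) 0 := by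
    have h2 : (1 / (2 * Complex.I) : ℂ) * 2 = -Complex.I := by
      field_simp; simp
    rw [jIm, hadj, hA, blockMatrix, blockMatrix, sub_eq_add_neg, Matrix.fromBlocks_neg,
      Matrix.fromBlocks_add, Matrix.fromBlocks_smul]
    congr 1
    · simp
    · rw [neg_neg, ← two_smul ℂ, smul_smul, h2]
    · rw [neg_neg, ← two_smul ℂ, smul_smul, h2]
    · simp
  set T : Matrix (Fin r) (Fin (n - r)) (MvPolynomial (Fin 3) ℂ) :=
    (X 1 : MvPolynomial (Fin 3) ℂ) • (-Complex.I • D).map C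
  set T' : Matrix (Fin (n - r)) (Fin r) (MvPolynomial (Fin 3) ℂ) :=
    (X 1 : MvPolynomial (Fin 3) ℂ) • (-Complex.I • Dᴴ).map C
  have hline : linePoly (signatureJ r n) A
      = (Matrix.fromBlocks (pencilForm α • 1) T T' (pencilForm β • 1)).det := by
    rw [linePoly, hre, him, blockMatrix]
    congr 1
    rw [← Matrix.fromBlocks_one, Matrix.fromBlocks_map, Matrix.fromBlocks_map,
      Matrix.fromBlocks_smul, Matrix.fromBlocks_smul, Matrix.fromBlocks_smul,
      Matrix.fromBlocks_add, Matrix.fromBlocks_add]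
    congr 1
    · ext i j : 2
      by_cases h : i = j
      · subst h; simp [pencilForm, mul_comm]
      · simp [h]
    · simp [T]
    · simp [T']
    · ext i j : 2
      by_cases h : i = j
      · subst h; simp [pencilForm, mul_comm]
      · simp [h]
  have hTT : -(T' * T) = (X 1 ^ 2 : MvPolynomial (Fin 3) ℂ) • (Dᴴ * D).map C := by
    have hD : (-Complex.I • Dᴴ) * (-Complex.I • D) = -(Dᴴ * D) := by
      rw [Matrix.smul_mul, Matrix.mul_smul, smul_smul, neg_mul_neg, Complex.I_mul_I, neg_one_smul]
    rw [Matrix.smul_mul, Matrix.mul_smul, smul_smul, ← Matrix.map_mul, hD, ← sq, ← smul_neg]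
    congr 1
    ext i j : 2
    simp
  have hdet := Matrix.det_fromBlocks_smul_one_mul_pow (pencilForm α) (pencilForm β) T T'
  rw [sub_eq_add_neg, hTT, (Matrix.isHermitian_conjTranspose_mul_self D).det_smul_one_add_smul_map]
    at hdet
  simpa [hline, conicForm] using hdet

/-! ### Irreducibility of the pencils and conics -/

theorem eval_pencilForm (t : ℝ) (q : Fin 3 → ℂ) : eval q (pencilForm t) = t * q 0 + q 2 := by
  simp [pencilForm]

theorem pencilForm_ne_zero (t : ℝ) : pencilForm t ≠ 0 := fun h => by
  simpa [eval_pencilForm] using congrArg (eval ![0, 0, 1]) h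

/-- Linear change of the line coordinates that takes the first two coordinates to the pencils at two
different real points. -/
noncomputable def pencilCoordinates {α β : ℝ} (h : α ≠ β) :
    MvPolynomial (Fin 3) ℂ ≃ₐ[ℂ] MvPolynomial (Fin 3) ℂ :=
  have h' : (α : ℂ) - β ≠ 0 := sub_ne_zero.mpr (Complex.ofReal_injective.ne h)
  AlgEquiv.ofAlgHom (aeval ![pencilForm α, pencilForm β, X 1])
    (aeval ![C ((α - β : ℂ)⁻¹) * (X 0 - X 1), X 2,
      C ((α - β : ℂ)⁻¹) * (C (α : ℂ) * X 1 - C (β : ℂ) * X 0)])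
    (by
      have hC : (C ((α - β : ℂ)⁻¹) : MvPolynomial (Fin 3) ℂ) * (C (α : ℂ) - C (β : ℂ)) = 1 := by
        rw [← C_sub, ← C_mul, inv_mul_cancel₀ h', C_1]
      ext i : 1
      fin_cases i
      · simp [pencilForm, algebraMap_eq]
        linear_combination (X 0) * hC
      · simp
      · simp [pencilForm, algebraMap_eq]
        linear_combination (X 2) * hC)
    (by
      have hC : (C ((α - β : ℂ)⁻¹) : MvPolynomial (Fin 3) ℂ) * (C (α : ℂ) - C (β : ℂ)) = 1 := by
        rw [← C_sub, ← C_mul, inv_mul_cancel₀ h', C_1]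
      ext i : 1
      fin_cases i
      · simp [pencilForm, algebraMap_eq]
        linear_combination (X 0) * hC
      · simp [pencilForm, algebraMap_eq]
        linear_combination (X 1) * hC
      · simp)

theorem pencilCoordinates_apply {α β : ℝ} (h : α ≠ β) (p : MvPolynomial (Fin 3) ℂ) :
    pencilCoordinates h p = aeval ![pencilForm α, pencilForm β, X 1] p := rfl

theorem irreducible_pencilForm (t : ℝ) : Irreducible (pencilForm t) := by
  have h : t ≠ t + 1 := by simp
  have h2 : pencilForm t = pencilCoordinates h (X 0) := by simp [pencilCoordinates_apply]
  rw [h2, MulEquiv.irreducible_iff (pencilCoordinates h)]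
  exact (X_prime (i := 0)).irreducible

/-- In the coordinates `pencilCoordinates` the conic is `X₁ X₀ + l X₂²`, of degree one in `X₀` with
coprime coefficients. -/
theorem irreducible_conicForm {α β l : ℝ} (h : α ≠ β) (hl : l ≠ 0) :
    Irreducible (conicForm α β l) := by
  have h2 : conicForm α β l = pencilCoordinates h (X 1 * X 0 + C (l : ℂ) * X 2 ^ 2) := by
    rw [pencilCoordinates_apply, map_add, map_mul, map_mul, map_pow, aeval_X, aeval_X, aeval_X,
      aeval_C, algebraMap_eq]
    exact congrArg (· + _) (mul_comm _ _)
  rw [h2, MulEquiv.irreducible_iff (pencilCoordinates h)]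
  refine irreducible_mul_X_add (X 1) (C (l : ℂ) * X 2 ^ 2) 0 (X_ne_zero 1) ?_ ?_ ?_
  · simp [vars_X]
  · intro hm
    have := vars_mul _ _ hm
    simp only [vars_C, Finset.empty_union] at this
    have := vars_pow _ _ this
    simp [vars_X] at this
  · refine ((X_prime (i := 1)).irreducible.isRelPrime_iff_not_dvd).mpr ?_
    rintro ⟨g, hg⟩
    have := congrArg (eval ![0, 0, 1]) hg
    simp [hl] at this

/-! ### Dual curves of the pencils and conics -/

/-- The dual curve uses only ratios of partial derivatives, so it does not see a nonzero scalar. -/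
theorem dualCurve_eq_of_associated {p q : MvPolynomial (Fin 3) ℂ} (h : Associated p q) :
    dualCurve p = dualCurve q := by
  obtain ⟨u, rfl⟩ := h
  obtain ⟨c, hc, hu⟩ := isUnit_iff_eq_C_of_isReduced.mp u.isUnit
  have hc0 := hc.ne_zero
  unfold dualCurve
  congr 1
  ext P
  simp only [Set.mem_ofPred_eq]
  refine exists_congr fun q => ?_
  rw [hu, mul_comm p (C c)]
  simp [hc0, mul_div_mul_left]

theorem realDual_eq_of_associated {p q : MvPolynomial (Fin 3) ℂ} (h : Associated p q) :
    realDual p = realDual q := by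
  rw [realDual, realDual, dualCurve_eq_of_associated h]

theorem eval_pderiv_pencilForm (t : ℝ) (q : Fin 3 → ℂ) (i : Fin 3) :
    eval q (pderiv i (pencilForm t)) = ![(t : ℂ), 0, 1] i := by
  fin_cases i <;> simp [pencilForm, pderiv_X]

theorem realDual_pencilForm (t : ℝ) : realDual (pencilForm t) = {(t : ℂ)} := by
  have h : dualCurve (pencilForm t) = {((t : ℂ), 0)} := by
    unfold dualCurve
    rw [← closure_singleton]
    congr 1
    ext P
    simp only [Set.mem_ofPred_eq, Set.mem_singleton_iff, eval_pencilForm, eval_pderiv_pencilForm]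
    constructor
    · rintro ⟨q, -, -, -, rfl⟩
      simp
    · rintro rfl
      refine ⟨![1, 0, -t], ?_, by simp, by simp, by simp⟩
      exact fun h => one_ne_zero (congrFun h 0)
  ext z
  rw [realDual, h]
  simp [Complex.ext_iff]

/-- A nondegenerate conic has no singular zeros, and its gradient map sends the zeros with finite
contact point onto the dual conic; this affine conic is already closed. -/
theorem dualCurve_conicForm {α β l : ℝ} (h : α ≠ β) (hl : l ≠ 0) :
    dualCurve (conicForm α β l) = {P : ℂ × ℂ |
      (P.1 - (α + β) / 2) ^ 2 / ((α - β) / 2) ^ 2 - P.2 ^ 2 / l = 1} := by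
  have h' : (α : ℂ) - β ≠ 0 := sub_ne_zero.mpr (Complex.ofReal_injective.ne h)
  have hl' : (l : ℂ) ≠ 0 := Complex.ofReal_ne_zero.mpr hl
  have hclosed : IsClosed {P : ℂ × ℂ |
      (P.1 - (α + β) / 2) ^ 2 / ((α - β) / 2) ^ 2 - P.2 ^ 2 / l = 1} :=
    isClosed_eq (by fun_prop) continuous_const
  unfold dualCurve
  rw [← hclosed.closure_eq]
  congr 1
  ext P
  have hev : ∀ q : Fin 3 → ℂ, eval q (conicForm α β l)
      = (α * q 0 + q 2) * (β * q 0 + q 2) + l * q 1 ^ 2 := by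
    intro q; simp [conicForm, eval_pencilForm]
  have h0 : ∀ q : Fin 3 → ℂ, eval q (pderiv 0 (conicForm α β l))
      = α * (β * q 0 + q 2) + (α * q 0 + q 2) * β := by
    intro q
    simp [conicForm, eval_pencilForm, eval_pderiv_pencilForm, pderiv_X]
    ring
  have h1 : ∀ q : Fin 3 → ℂ, eval q (pderiv 1 (conicForm α β l)) = 2 * l * q 1 := by
    intro q
    simp [conicForm, eval_pencilForm, eval_pderiv_pencilForm, pderiv_X]
    ring
  have h2 : ∀ q : Fin 3 → ℂ, eval q (pderiv 2 (conicForm α β l))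
      = (β * q 0 + q 2) + (α * q 0 + q 2) := by
    intro q
    simp [conicForm, eval_pencilForm, eval_pderiv_pencilForm, pderiv_X]
    ring
  simp only [Set.mem_ofPred_eq, hev, h0, h1, h2]
  constructor
  · rintro ⟨q, -, hq, hd, rfl⟩
    field_simp
    linear_combination (-4 * (α - β : ℂ) ^ 2) * hq
  · intro hP
    obtain ⟨x, y⟩ := P
    simp only at hP
    -- the tangent line at `(x, y)`, normalised so that its value at the centre is `1`
    set u : ℂ := -(x - (α + β) / 2) / ((α - β) / 2) ^ 2 with hu
    have hux : x = (α + β) / 2 - u * ((α - β) / 2) ^ 2 := by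
      rw [hu]; field_simp; ring
    have hden : (β * u + (1 - u * (α + β) / 2)) + (α * u + (1 - u * (α + β) / 2)) = (2 : ℂ) := by
      ring
    have hP2 : ((α - β) / 2) ^ 2 * u ^ 2 - y ^ 2 / l = (1 : ℂ) := by
      rw [← hP, hu]; field_simp
    refine ⟨![u, y / l, 1 - u * (α + β) / 2], ?_, ?_, ?_, ?_⟩
    · intro h0
      have e0 : u = 0 := congrFun h0 0
      have e2 : 1 - u * (α + β) / 2 = 0 := congrFun h0 2
      simp [e0] at e2
    · simp
      field_simp at hP2 ⊢
      linear_combination (-1) * hP2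
    · simp [hden]
    · simp only [Matrix.cons_val_zero, Matrix.cons_val_one, Matrix.cons_val, hden, Prod.mk.injEq]
      constructor
      · rw [hux]; ring
      · field_simp

theorem sq_norm_half_sub (α β : ℝ) : ‖((α : ℂ) - β) / 2‖ ^ 2 = ((α - β) / 2) ^ 2 := by
  have h : ((α : ℂ) - β) / 2 = (((α - β) / 2 : ℝ) : ℂ) := by push_cast; rfl
  rw [h, Complex.norm_real, Real.norm_eq_abs, sq_abs]

theorem half_add_eq_ofReal (α β : ℝ) : ((α : ℂ) + β) / 2 = (((α + β) / 2 : ℝ) : ℂ) := by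
  push_cast; rfl

theorem realDual_conicForm {α β t : ℝ} (h : α ≠ β) (ht : t ≠ 0) :
    realDual (conicForm α β (t ^ 2))
      = hyperbola (((α : ℂ) + β) / 2) ‖((α : ℂ) - β) / 2‖ t := by
  ext z
  rw [realDual, hyperbola, dualCurve_conicForm h (pow_ne_zero 2 ht), Set.mem_ofPred_eq,
    Set.mem_ofPred_eq, Set.mem_ofPred_eq, sq_norm_half_sub, half_add_eq_ofReal, Complex.ofReal_re, Complex.ofReal_im, sub_zero,
    ← Complex.ofReal_inj]
  push_cast
  rfl

/-! ### Factorization of the determinant and the components of the curve -/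

/-- The nonzero singular values are the square roots of the positive eigenvalues
of `D* D`, which is the form in which they enter the determinant. -/
theorem mem_nonzeroSingularValues_iff {m k : ℕ} (D : Matrix (Fin m) (Fin k) ℂ) (t : ℝ) :
    t ∈ nonzeroSingularValues D ↔
      0 < t ∧ ∃ j, (Matrix.isHermitian_conjTranspose_mul_self D).eigenvalues j = t ^ 2 := by
  set hE := Matrix.isHermitian_conjTranspose_mul_self D
  have hcomp : D.toEuclideanLin.adjoint ∘ₗ D.toEuclideanLin = (Dᴴ * D).toEuclideanLin := by
    rw [← Matrix.toEuclideanLin_conjTranspose_eq_adjoint]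
    exact (Matrix.toLpLin_mul_same 2 Dᴴ D).symm
  have key : ∀ (S : EuclideanSpace ℂ (Fin k) →ₗ[ℂ] EuclideanSpace ℂ (Fin k))
      (hS : S.IsSymmetric), S = (Dᴴ * D).toEuclideanLin →
      hS.eigenvalues finrank_euclideanSpace = hE.eigenvalues₀ := by
    rintro _ hS rfl
    rfl
  have hval : ∀ i : Fin (Fintype.card (Fin k)),
      D.toEuclideanLin.singularValues i ^ 2 = hE.eigenvalues₀ i := fun i => by
    rw [← key _ D.toEuclideanLin.isSymmetric_adjoint_comp_self hcomp]
    exact LinearMap.sq_singularValues_fin _ _ i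
  constructor
  · rintro ⟨ht, i, rfl⟩
    refine ⟨lt_of_le_of_ne (LinearMap.singularValues_nonneg _ _) ht.symm, ?_⟩
    have hi : i < Fintype.card (Fin k) := by
      by_contra! hi
      exact ht (LinearMap.singularValues_of_finrank_le _ (finrank_euclideanSpace.le.trans hi))
    refine ⟨(Fintype.equivOfCardEq (Fintype.card_fin _)) ⟨i, hi⟩, ?_⟩
    rw [hval ⟨i, hi⟩, Matrix.IsHermitian.eigenvalues, Equiv.symm_apply_apply]
  · rintro ⟨ht, j, hj⟩
    refine ⟨ht.ne', ((Fintype.equivOfCardEq (Fintype.card_fin _)).symm j :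
      Fin (Fintype.card (Fin k))), ?_⟩
    rw [← sq_eq_sq₀ (LinearMap.singularValues_nonneg _ _) ht.le, hval, ← hj]
    rfl

/-- Each zero eigenvalue of `D* D` contributes a pair of pencils to `linePoly_mul_pow`; cancelling the
powers of `pencilForm α` leaves the exponents `r - rank D` and `n - r - rank D`. -/
theorem linePoly_eq {r n : ℕ} (α β : ℝ) (D : Matrix (Fin r) (Fin (n - r)) ℂ) :
    linePoly (signatureJ r n) (blockMatrix (α : ℂ) (β : ℂ) D Dᴴ)
      = pencilForm α ^ (r - D.rank) * pencilForm β ^ (n - r - D.rank) *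
        ∏ j with (Matrix.isHermitian_conjTranspose_mul_self D).eigenvalues j ≠ 0, conicForm α β
          ((Matrix.isHermitian_conjTranspose_mul_self D).eigenvalues j) := by
  have h := linePoly_mul_pow α β D
  set hE := Matrix.isHermitian_conjTranspose_mul_self D
  set N := Finset.univ.filter fun j => hE.eigenvalues j ≠ 0 with hN
  have hcard : N.card = D.rank := by
    rw [← Matrix.rank_conjTranspose_mul_self, hE.rank_eq_card_non_zero_eigs, Fintype.card_subtype]
  have hcard' : (Finset.univ.filter fun j => ¬ hE.eigenvalues j ≠ 0).card = n - r - D.rank := by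
    have h2 := Finset.card_filter_add_card_filter_not (s := (Finset.univ : Finset (Fin (n - r))))
      (fun j => hE.eigenvalues j ≠ 0)
    rw [Finset.card_univ, Fintype.card_fin] at h2
    rw [← hN, hcard] at h2
    omega
  -- the conic of a zero eigenvalue splits into the two pencils
  have hzero : ∏ j with ¬ hE.eigenvalues j ≠ 0, conicForm α β (hE.eigenvalues j)
      = (pencilForm α * pencilForm β) ^ (n - r - D.rank) := by
    rw [← hcard']
    refine Finset.prod_eq_pow_card fun j hj => ?_
    have : hE.eigenvalues j = 0 := by simpa using hj
    simp [conicForm, this]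
  have hkr : D.rank ≤ r := by simpa using D.rank_le_height
  have hkn : D.rank ≤ n - r := by simpa using D.rank_le_width
  rw [← Finset.prod_filter_mul_prod_filter_not _ (fun j => hE.eigenvalues j ≠ 0), hzero] at h
  refine mul_right_cancel₀ (pow_ne_zero (n - r) (pencilForm_ne_zero α)) (h.trans ?_)
  have hexp : pencilForm α ^ r * pencilForm α ^ (n - r - D.rank)
      = pencilForm α ^ (r - D.rank) * pencilForm α ^ (n - r) := by
    rw [← pow_add, ← pow_add]
    congr 1
    omega
  rw [mul_pow]
  linear_combination (pencilForm β ^ (n - r - D.rank) *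
    ∏ j with hE.eigenvalues j ≠ 0, conicForm α β (hE.eigenvalues j)) * hexp

theorem irreducible_dvd_linePoly_iff {r n : ℕ} {α β : ℝ} (hαβ : α ≠ β)
    (D : Matrix (Fin r) (Fin (n - r)) ℂ) {p : MvPolynomial (Fin 3) ℂ} (hp : Irreducible p) :
    p ∣ linePoly (signatureJ r n) (blockMatrix (α : ℂ) (β : ℂ) D Dᴴ) ↔
      (∃ t ∈ nonzeroSingularValues D, Associated p (conicForm α β (t ^ 2))) ∨
      (Associated p (pencilForm α) ∧ D.rank < r) ∨
      (Associated p (pencilForm β) ∧ D.rank < n - r) := by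
  rw [linePoly_eq]
  set hE := Matrix.isHermitian_conjTranspose_mul_self D
  have hpos : ∀ j, 0 ≤ hE.eigenvalues j :=
    (Matrix.posSemidef_conjTranspose_mul_self D).eigenvalues_nonneg
  constructor
  · intro h
    rcases hp.prime.dvd_or_dvd h with h | h
    · rcases hp.prime.dvd_or_dvd h with h | h
      · refine Or.inr (Or.inl ⟨hp.associated_of_dvd (irreducible_pencilForm α)
          (hp.prime.dvd_of_dvd_pow h), ?_⟩)
        by_contra! hr
        rw [Nat.sub_eq_zero_of_le hr, pow_zero] at h
        exact hp.not_isUnit (isUnit_of_dvd_one h)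
      · refine Or.inr (Or.inr ⟨hp.associated_of_dvd (irreducible_pencilForm β)
          (hp.prime.dvd_of_dvd_pow h), ?_⟩)
        by_contra! hr
        rw [Nat.sub_eq_zero_of_le hr, pow_zero] at h
        exact hp.not_isUnit (isUnit_of_dvd_one h)
    · obtain ⟨j, hj, hd⟩ := (Prime.dvd_finsetProd_iff hp.prime _).mp h
      have hj0 : hE.eigenvalues j ≠ 0 := by simpa using hj
      refine Or.inl ⟨√(hE.eigenvalues j), (mem_nonzeroSingularValues_iff D _).mpr
        ⟨Real.sqrt_pos.mpr ((hpos j).lt_of_ne hj0.symm), j, (Real.sq_sqrt (hpos j)).symm⟩, ?_⟩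
      rw [Real.sq_sqrt (hpos j)]
      exact hp.associated_of_dvd (irreducible_conicForm hαβ hj0) hd
  · rintro (⟨t, ht, h⟩ | ⟨h, hk⟩ | ⟨h, hk⟩)
    · obtain ⟨ht0, j, hj⟩ := (mem_nonzeroSingularValues_iff D t).mp ht
      refine h.dvd.trans (Dvd.dvd.mul_left ?_ _)
      rw [← hj]
      refine Finset.dvd_prod_of_mem (fun j => conicForm α β (hE.eigenvalues j)) ?_
      simp [hj, ht0.ne']
    · exact h.dvd.trans (((dvd_pow_self _ (by omega)).mul_right _).mul_right _)
    · exact h.dvd.trans (((dvd_pow_self _ (by omega)).mul_left _).mul_right _)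

theorem kippenhahnComponents_blockMatrix {r n : ℕ} {α β : ℝ} (hαβ : α ≠ β)
    (D : Matrix (Fin r) (Fin (n - r)) ℂ) :
    kippenhahnComponents (signatureJ r n) (blockMatrix (α : ℂ) (β : ℂ) D Dᴴ)
      = (hyperbola (((α : ℂ) + β) / 2) ‖((α : ℂ) - β) / 2‖ '' nonzeroSingularValues D)
        ∪ {S | S = {(α : ℂ)} ∧ D.rank < r} ∪ {S | S = {(β : ℂ)} ∧ D.rank < n - r} := by
  ext S
  constructor
  · rintro ⟨p, hp, hd, rfl⟩
    rcases (irreducible_dvd_linePoly_iff hαβ D hp).mp hd with ⟨t, ht, h⟩ | ⟨h, hk⟩ | ⟨h, hk⟩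
    · refine Or.inl (Or.inl ⟨t, ht, ?_⟩)
      rw [realDual_eq_of_associated h, realDual_conicForm hαβ ht.1]
    · exact Or.inl (Or.inr ⟨by rw [realDual_eq_of_associated h, realDual_pencilForm], hk⟩)
    · exact Or.inr ⟨by rw [realDual_eq_of_associated h, realDual_pencilForm], hk⟩
  · rintro ((⟨t, ht, rfl⟩ | ⟨rfl, hk⟩) | ⟨rfl, hk⟩)
    · have hi := irreducible_conicForm hαβ (pow_ne_zero 2 ht.1)
      exact ⟨_, hi, (irreducible_dvd_linePoly_iff hαβ D hi).mpr (Or.inl ⟨t, ht, .refl _⟩),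
        (realDual_conicForm hαβ ht.1).symm⟩
    · have hi := irreducible_pencilForm α
      exact ⟨_, hi, (irreducible_dvd_linePoly_iff hαβ D hi).mpr (Or.inr (Or.inl ⟨.refl _, hk⟩)),
        (realDual_pencilForm α).symm⟩
    · have hi := irreducible_pencilForm β
      exact ⟨_, hi, (irreducible_dvd_linePoly_iff hαβ D hi).mpr (Or.inr (Or.inr ⟨.refl _, hk⟩)),
        (realDual_pencilForm β).symm⟩

end KreinRange

/-! ### The largest singular value of a linear map -/

namespace LinearMap

variable {𝕜 E F : Type*} [RCLike 𝕜] [NormedAddCommGroup E] [InnerProductSpace 𝕜 E]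
  [FiniteDimensional 𝕜 E] [NormedAddCommGroup F] [InnerProductSpace 𝕜 F] [FiniteDimensional 𝕜 F]
  (T : E →ₗ[𝕜] F)

theorem norm_sq_apply_eq_sum_singularValues (x : E) :
    ‖T x‖ ^ 2 = ∑ i : Fin (Module.finrank 𝕜 E), T.singularValues i ^ 2 *
      ‖⟪T.isSymmetric_adjoint_comp_self.eigenvectorBasis rfl i, x⟫_𝕜‖ ^ 2 := by
  set b := T.isSymmetric_adjoint_comp_self.eigenvectorBasis rfl
  have h1 : ⟪T x, T x⟫_𝕜 = ⟪(T.adjoint ∘ₗ T) x, x⟫_𝕜 := by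
    rw [coe_comp, Function.comp_apply, adjoint_inner_left]
  have h2 : ⟪T x, T x⟫_𝕜 = ((∑ i : Fin (Module.finrank 𝕜 E), T.singularValues i ^ 2 * ‖⟪b i, x⟫_𝕜‖ ^ 2 : ℝ) : 𝕜) := by
    rw [h1, ← b.sum_inner_mul_inner]
    push_cast
    refine Finset.sum_congr rfl fun i _ => ?_
    rw [← coe_comp, T.isSymmetric_adjoint_comp_self, T.isSymmetric_adjoint_comp_self.apply_eigenvectorBasis,
      inner_smul_right, ← T.sq_singularValues_fin rfl i, mul_assoc, ← inner_conj_symm x,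
      RCLike.conj_mul]
    push_cast
    rfl
  rw [inner_self_eq_norm_sq_to_K] at h2
  exact_mod_cast h2

theorem norm_apply_le_singularValues_zero (x : E) : ‖T x‖ ≤ T.singularValues 0 * ‖x‖ := by
  refine le_of_sq_le_sq ?_ (mul_nonneg (T.singularValues_nonneg 0) (norm_nonneg x))
  rw [norm_sq_apply_eq_sum_singularValues, mul_pow,
    ← (T.isSymmetric_adjoint_comp_self.eigenvectorBasis rfl).sum_sq_norm_inner_right x,
    Finset.mul_sum]
  refine Finset.sum_le_sum fun i _ => mul_le_mul_of_nonneg_right ?_ (sq_nonneg _)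
  exact pow_le_pow_left₀ (T.singularValues_nonneg _) (T.singularValues_antitone (Nat.zero_le _)) 2

theorem singularValues_zero_pos (h : T ≠ 0) : 0 < T.singularValues 0 := by
  rw [singularValues_pos_iff_lt_finrank_range, Module.finrank_pos_iff,
    Submodule.nontrivial_iff_ne_bot]
  exact fun hb => h (range_eq_bot.mp hb)

/-- The largest singular value is attained by a pair of singular vectors. -/
theorem exists_inner_eq_singularValues_zero (h : T ≠ 0) :
    ∃ (u : F) (v : E), ‖u‖ = 1 ∧ ‖v‖ = 1 ∧ ⟪u, T v⟫_𝕜 = (T.singularValues 0 : 𝕜) := by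
  have h0 := T.singularValues_zero_pos h
  have hd : 0 < Module.finrank 𝕜 E := by
    by_contra! hd
    exact h0.ne' (T.singularValues_of_finrank_le hd)
  set v := T.isSymmetric_adjoint_comp_self.eigenvectorBasis rfl ⟨0, hd⟩ with hv
  have hTv : ⟪T v, T v⟫_𝕜 = (T.singularValues 0 : 𝕜) ^ 2 := by
    rw [← adjoint_inner_right, ← Function.comp_apply (f := T.adjoint), ← coe_comp, hv,
      T.isSymmetric_adjoint_comp_self.apply_eigenvectorBasis, inner_smul_right,
      ← T.sq_singularValues_fin rfl ⟨0, hd⟩, inner_self_eq_norm_sq_to_K,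
      OrthonormalBasis.norm_eq_one]
    simp
  have hn : ‖T v‖ = T.singularValues 0 := by
    rw [inner_self_eq_norm_sq_to_K] at hTv
    rw [← sq_eq_sq₀ (norm_nonneg _) h0.le]
    exact_mod_cast hTv
  refine ⟨((T.singularValues 0 : 𝕜)⁻¹) • T v, v, ?_, OrthonormalBasis.norm_eq_one _ _, ?_⟩
  · rw [norm_smul, norm_inv, hn, RCLike.norm_ofReal, abs_of_pos h0, inv_mul_cancel₀ h0.ne']
  · have h0' : (T.singularValues 0 : 𝕜) ≠ 0 := RCLike.ofReal_ne_zero.mpr h0.ne'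
    rw [inner_smul_left, hTv, map_inv₀, RCLike.conj_ofReal]
    field_simp

end LinearMap

/-! ### Geometry of hyperbolic discs -/

namespace KreinRange

theorem hyperbolicDisc_ssubset {c : ℂ} {a b₁ b₂ : ℝ} (ha : a ≠ 0) (hb₁ : 0 < b₁) (hb : b₁ < b₂) :
    hyperbolicDisc c a b₁ ⊂ hyperbolicDisc c a b₂ := by
  have hb₂ := hb₁.trans hb
  rw [Set.ssubset_iff_of_subset]
  · -- the point of the outer hyperbola at height `b₂`
    refine ⟨⟨c.re + √2 * a, c.im + b₂⟩, ?_, ?_⟩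
    · simp only [hyperbolicDisc, Set.mem_ofPred_eq, add_sub_cancel_left, mul_pow]
      rw [Real.sq_sqrt (by norm_num)]
      field_simp
      norm_num
    · simp only [hyperbolicDisc, Set.mem_ofPred_eq, add_sub_cancel_left, mul_pow, not_le]
      rw [Real.sq_sqrt (by norm_num), mul_div_assoc, div_self (pow_ne_zero 2 ha)]
      have : 1 < b₂ ^ 2 / b₁ ^ 2 := (one_lt_div (by positivity)).mpr (by gcongr)
      linarith
  · intro z hz
    simp only [hyperbolicDisc, Set.mem_ofPred_eq] at hz ⊢
    have : (z.im - c.im) ^ 2 / b₂ ^ 2 ≤ (z.im - c.im) ^ 2 / b₁ ^ 2 := by gcongr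
    linarith

/-- The points of abscissa `√2 a` from the centre have height exactly `±b`. -/
theorem hyperbola_injective {c : ℂ} {a b₁ b₂ : ℝ} (ha : a ≠ 0) (hb₁ : 0 < b₁) (hb₂ : 0 < b₂)
    (h : hyperbola c a b₁ = hyperbola c a b₂) : b₁ = b₂ := by
  have hmem : (⟨c.re + √2 * a, c.im + b₁⟩ : ℂ) ∈ hyperbola c a b₁ := by
    simp only [hyperbola, Set.mem_ofPred_eq, add_sub_cancel_left, mul_pow]
    rw [Real.sq_sqrt (by norm_num)]
    field_simp
    norm_num
  rw [h] at hmem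
  simp only [hyperbola, Set.mem_ofPred_eq, add_sub_cancel_left, mul_pow] at hmem
  rw [Real.sq_sqrt (by norm_num), mul_div_assoc, div_self (pow_ne_zero 2 ha)] at hmem
  have h1 : b₁ ^ 2 / b₂ ^ 2 = 1 := by linarith
  rw [div_eq_one_iff_eq (by positivity)] at h1
  exact (sq_eq_sq₀ hb₁.le hb₂.le).mp h1

theorem frontier_hyperbolicDisc (c : ℂ) (a b : ℝ) :
    frontier (hyperbolicDisc c a b) = hyperbola c a b := by
  set f : ℂ → ℝ := fun z => (z.re - c.re) ^ 2 / a ^ 2 - (z.im - c.im) ^ 2 / b ^ 2 with hf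
  have hcont : Continuous f := by fun_prop
  apply Set.Subset.antisymm
  · intro z hz
    exact (frontier_le_subset_eq continuous_const hcont hz).symm
  · intro z hz
    have hz1 : f z = 1 := hz
    refine ⟨subset_closure hz1.ge, fun hint => ?_⟩
    -- contracting towards the centre leaves the disc
    have hpath : Filter.Tendsto (fun ε : ℝ => c + ((1 - ε : ℝ) : ℂ) * (z - c))
        (nhdsWithin 0 (Set.Ioi 0)) (nhds z) := by
      have : Continuous (fun ε : ℝ => c + ((1 - ε : ℝ) : ℂ) * (z - c)) := by fun_prop
      have h := this.tendsto 0
      simp only [sub_zero, Complex.ofReal_one, one_mul, add_sub_cancel] at h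
      exact h.mono_left nhdsWithin_le_nhds
    have hev := hpath.eventually (mem_interior_iff_mem_nhds.mp hint)
    have hlt : ∀ᶠ ε : ℝ in nhdsWithin 0 (Set.Ioi 0), ε ∈ Set.Ioo (0 : ℝ) 1 :=
      Ioo_mem_nhdsGT one_pos
    obtain ⟨ε, hε, hε0, hε1⟩ := (hev.and hlt).exists
    have hval : f (c + ((1 - ε : ℝ) : ℂ) * (z - c)) = (1 - ε) ^ 2 * f z := by
      simp only [hf, Complex.add_re, Complex.re_ofReal_mul, Complex.add_im, Complex.im_ofReal_mul,
        Complex.sub_re, Complex.sub_im]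
      ring
    have h1 : 1 ≤ f (c + ((1 - ε : ℝ) : ℂ) * (z - c)) := hε
    rw [hval, hz1] at h1
    nlinarith

/-! ### The Krein space numerical range -/

section Range

variable {r n : ℕ} (α β : ℝ) (D : Matrix (Fin r) (Fin (n - r)) ℂ)
  (ξ : EuclideanSpace ℂ (Fin r)) (η : EuclideanSpace ℂ (Fin (n - r)))

theorem star_dotProduct_ofLp {k : ℕ} (x y : EuclideanSpace ℂ (Fin k)) :
    star x.ofLp ⬝ᵥ y.ofLp = ⟪x, y⟫_ℂ := by
  rw [EuclideanSpace.inner_eq_star_dotProduct, dotProduct_comm]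

theorem indefInner_signatureJ_self :
    indefInner (signatureJ r n) (Sum.elim ξ.ofLp η.ofLp) (Sum.elim ξ.ofLp η.ofLp)
      = ((‖ξ‖ ^ 2 - ‖η‖ ^ 2 : ℝ) : ℂ) := by
  have hs : star (Sum.elim ξ.ofLp η.ofLp) = Sum.elim (star ξ.ofLp) (star η.ofLp) := by
    ext i; cases i <;> rfl
  rw [indefInner, signatureJ, Matrix.fromBlocks_mulVec, hs, sumElim_dotProduct_sumElim]
  simp only [Sum.elim_comp_inl, Sum.elim_comp_inr, Matrix.one_mulVec, Matrix.zero_mulVec,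
    Matrix.neg_mulVec, add_zero, zero_add, dotProduct_neg, star_dotProduct_ofLp,
    inner_self_eq_norm_sq_to_K]
  push_cast
  rfl

theorem indefInner_blockMatrix :
    indefInner (signatureJ r n) ((blockMatrix (α : ℂ) (β : ℂ) D Dᴴ).mulVec
        (Sum.elim ξ.ofLp η.ofLp)) (Sum.elim ξ.ofLp η.ofLp)
      = ⟨α * ‖ξ‖ ^ 2 - β * ‖η‖ ^ 2, 2 * (⟪ξ, D.toEuclideanLin η⟫_ℂ).im⟩ := by
  have hs : star (Sum.elim ξ.ofLp η.ofLp) = Sum.elim (star ξ.ofLp) (star η.ofLp) := by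
    ext i; cases i <;> rfl
  have h1 : star ξ.ofLp ⬝ᵥ D *ᵥ η.ofLp = ⟪ξ, D.toEuclideanLin η⟫_ℂ := by
    rw [← star_dotProduct_ofLp]; rfl
  have h2 : star η.ofLp ⬝ᵥ Dᴴ *ᵥ ξ.ofLp = (starRingEnd ℂ) ⟪ξ, D.toEuclideanLin η⟫_ℂ := by
    rw [inner_conj_symm, ← LinearMap.adjoint_inner_right,
      ← Matrix.toEuclideanLin_conjTranspose_eq_adjoint, ← star_dotProduct_ofLp]
    rfl
  rw [indefInner, signatureJ, blockMatrix, Matrix.fromBlocks_mulVec, Matrix.fromBlocks_mulVec, hs,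
    sumElim_dotProduct_sumElim]
  simp only [Sum.elim_comp_inl, Sum.elim_comp_inr, Matrix.one_mulVec, Matrix.zero_mulVec,
    Matrix.neg_mulVec, add_zero, zero_add, dotProduct_neg, dotProduct_add, Matrix.smul_mulVec,
    dotProduct_smul, star_dotProduct_ofLp, inner_self_eq_norm_sq_to_K, h1, h2]
  generalize ⟪ξ, D.toEuclideanLin η⟫_ℂ = w
  apply Complex.ext <;> simp [← Complex.ofReal_pow] <;> ring

theorem mem_rangePlus_iff (z : ℂ) :
    z ∈ rangePlus (signatureJ r n) (blockMatrix (α : ℂ) (β : ℂ) D Dᴴ) ↔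
      ∃ (ξ : EuclideanSpace ℂ (Fin r)) (η : EuclideanSpace ℂ (Fin (n - r))),
        ‖ξ‖ ^ 2 - ‖η‖ ^ 2 = 1 ∧
        z = ⟨α * ‖ξ‖ ^ 2 - β * ‖η‖ ^ 2, 2 * (⟪ξ, D.toEuclideanLin η⟫_ℂ).im⟩ := by
  constructor
  · rintro ⟨x, h1, rfl⟩
    refine ⟨WithLp.toLp 2 (x ∘ Sum.inl), WithLp.toLp 2 (x ∘ Sum.inr), ?_, ?_⟩
    · rw [← Complex.ofReal_inj, ← indefInner_signatureJ_self, Sum.elim_comp_inl_inr, h1,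
        Complex.ofReal_one]
    · rw [← indefInner_blockMatrix, Sum.elim_comp_inl_inr]
  · rintro ⟨ξ, η, h1, rfl⟩
    refine ⟨Sum.elim ξ.ofLp η.ofLp, ?_, (indefInner_blockMatrix α β D ξ η).symm⟩
    rw [indefInner_signatureJ_self, h1, Complex.ofReal_one]

theorem mem_rangeMinus_iff (z : ℂ) :
    z ∈ rangeMinus (signatureJ r n) (blockMatrix (α : ℂ) (β : ℂ) D Dᴴ) ↔
      ∃ (ξ : EuclideanSpace ℂ (Fin r)) (η : EuclideanSpace ℂ (Fin (n - r))),
        ‖ξ‖ ^ 2 - ‖η‖ ^ 2 = -1 ∧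
        z = ⟨α * ‖ξ‖ ^ 2 - β * ‖η‖ ^ 2, 2 * (⟪ξ, D.toEuclideanLin η⟫_ℂ).im⟩ := by
  constructor
  · rintro ⟨x, h1, rfl⟩
    refine ⟨WithLp.toLp 2 (x ∘ Sum.inl), WithLp.toLp 2 (x ∘ Sum.inr), ?_, ?_⟩
    · rw [← Complex.ofReal_inj, ← indefInner_signatureJ_self, Sum.elim_comp_inl_inr, h1,
        Complex.ofReal_neg, Complex.ofReal_one]
    · rw [← indefInner_blockMatrix, Sum.elim_comp_inl_inr]
  · rintro ⟨ξ, η, h1, rfl⟩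
    refine ⟨Sum.elim ξ.ofLp η.ofLp, ?_, (indefInner_blockMatrix α β D ξ η).symm⟩
    rw [indefInner_signatureJ_self, h1, Complex.ofReal_neg, Complex.ofReal_one]

variable {D}

theorem sq_im_inner_toEuclideanLin_le :
    (⟪ξ, D.toEuclideanLin η⟫_ℂ).im ^ 2
      ≤ D.toEuclideanLin.singularValues 0 ^ 2 * (‖ξ‖ ^ 2 * ‖η‖ ^ 2) := by
  have h1 : |(⟪ξ, D.toEuclideanLin η⟫_ℂ).im|
      ≤ ‖ξ‖ * (D.toEuclideanLin.singularValues 0 * ‖η‖) :=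
    (Complex.abs_im_le_norm _).trans ((norm_inner_le_norm _ _).trans
      (mul_le_mul_of_nonneg_left (LinearMap.norm_apply_le_singularValues_zero _ _)
        (norm_nonneg _)))
  calc _ = |(⟪ξ, D.toEuclideanLin η⟫_ℂ).im| ^ 2 := (sq_abs _).symm
    _ ≤ (‖ξ‖ * (D.toEuclideanLin.singularValues 0 * ‖η‖)) ^ 2 := by gcongr
    _ = _ := by ring

theorem exists_norm_eq_one_im_mul_eq {B Y : ℝ} (h : Y ^ 2 ≤ B ^ 2) :
    ∃ e : ℂ, ‖e‖ = 1 ∧ e.im * B = Y := by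
  rcases eq_or_ne B 0 with rfl | hB
  · exact ⟨1, by simp, by nlinarith⟩
  · have h1 : (Y / B) ^ 2 ≤ 1 := by
      rw [div_pow]
      exact div_le_one_of_le₀ h (sq_nonneg B)
    refine ⟨⟨√(1 - (Y / B) ^ 2), Y / B⟩, ?_, div_mul_cancel₀ Y hB⟩
    rw [← sq_eq_sq₀ (norm_nonneg _) zero_le_one, Complex.sq_norm, Complex.normSq_mk,
      ← sq, ← sq, Real.sq_sqrt (by linarith)]
    ring

/-- Rotating the phases of a pair of leading singular vectors, the bound
`sq_im_inner_toEuclideanLin_le` is sharp and all smaller values are attained. -/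
theorem exists_im_inner_toEuclideanLin_eq (hD : D.toEuclideanLin ≠ 0) {a b Y : ℝ} (ha : 0 ≤ a)
    (hb : 0 ≤ b) (h : Y ^ 2 ≤ D.toEuclideanLin.singularValues 0 ^ 2 * (a * b)) :
    ∃ (ξ : EuclideanSpace ℂ (Fin r)) (η : EuclideanSpace ℂ (Fin (n - r))),
      ‖ξ‖ ^ 2 = a ∧ ‖η‖ ^ 2 = b ∧ (⟪ξ, D.toEuclideanLin η⟫_ℂ).im = Y := by
  obtain ⟨u, v, hu, hv, huv⟩ := LinearMap.exists_inner_eq_singularValues_zero D.toEuclideanLin hD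
  obtain ⟨e, he, heY⟩ := exists_norm_eq_one_im_mul_eq
    (B := √a * √b * D.toEuclideanLin.singularValues 0) (Y := Y) (by
      rw [mul_pow, mul_pow, Real.sq_sqrt ha, Real.sq_sqrt hb]
      linarith)
  refine ⟨((√a : ℝ) : ℂ) • u, (((√b : ℝ) : ℂ) * e) • v, ?_, ?_, ?_⟩
  · rw [norm_smul, hu, mul_one, Complex.norm_real, Real.norm_eq_abs, sq_abs, Real.sq_sqrt ha]
  · rw [norm_smul, hv, norm_mul, he, mul_one, mul_one, Complex.norm_real, Real.norm_eq_abs, sq_abs,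
      Real.sq_sqrt hb]
  · rw [map_smul, inner_smul_left, inner_smul_right, huv, Complex.conj_ofReal, ← heY]
    simp
    ring

/-- With `‖ξ‖² - ‖η‖² = ±1`, the real part of a value depends only on `‖η‖` (or `‖ξ‖`), while its
imaginary part ranges over the interval given by the largest singular value. -/
theorem kreinRange_blockMatrix {α β : ℝ} (hαβ : α ≠ β) (hD : D.toEuclideanLin ≠ 0) :
    kreinRange (signatureJ r n) (blockMatrix (α : ℂ) (β : ℂ) D Dᴴ)
      = hyperbolicDisc (((α : ℂ) + β) / 2) ‖((α : ℂ) - β) / 2‖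
          (D.toEuclideanLin.singularValues 0) := by
  have hpos := LinearMap.singularValues_zero_pos _ hD
  set M := D.toEuclideanLin.singularValues 0 with hM
  have hw : (α - β) / 2 ≠ 0 := div_ne_zero (sub_ne_zero.mpr hαβ) two_ne_zero
  set w := (α - β) / 2 with hwdef
  ext z
  simp only [kreinRange, hyperbolicDisc, sq_norm_half_sub, half_add_eq_ofReal, Complex.ofReal_re,
    Complex.ofReal_im, sub_zero, Set.mem_union, Set.mem_ofPred_eq, mem_rangePlus_iff, mem_rangeMinus_iff]
  -- both parts of the range amount to `X = ± w (1 + 2t)`, `Y² ≤ 4 M² t (1 + t)`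
  have bound : ∀ {t Y : ℝ}, Y ^ 2 ≤ M ^ 2 * (t * (1 + t)) →
      1 ≤ (w * (1 + 2 * t)) ^ 2 / w ^ 2 - (2 * Y) ^ 2 / M ^ 2 := by
    intro t Y h
    have h1 : Y ^ 2 / M ^ 2 ≤ t * (1 + t) := by
      rw [div_le_iff₀ (by positivity)]; linarith
    have h2 : (w * (1 + 2 * t)) ^ 2 / w ^ 2 = (1 + 2 * t) ^ 2 := by field_simp
    have h3 : (2 * Y) ^ 2 / M ^ 2 = 4 * (Y ^ 2 / M ^ 2) := by ring
    rw [h2, h3]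
    linarith
  constructor
  · rintro (⟨ξ, η, h1, hz⟩ | ⟨ξ, η, h1, rfl⟩)
    · have hb := sq_im_inner_toEuclideanLin_le (D := D) ξ η
      rw [← hM, show ‖η‖ ^ 2 = 1 + ‖ξ‖ ^ 2 by linarith] at hb
      have h := bound hb
      have hre : z.re = -(α * ‖ξ‖ ^ 2 - β * ‖η‖ ^ 2) := by
        rw [← neg_eq_iff_eq_neg]; simpa using congrArg Complex.re hz
      have him : z.im = -(2 * (⟪ξ, D.toEuclideanLin η⟫_ℂ).im) := by
        rw [← neg_eq_iff_eq_neg]; simpa using congrArg Complex.im hz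
      have hX : z.re - (α + β) / 2 = -(w * (1 + 2 * ‖ξ‖ ^ 2)) := by
        rw [hre, hwdef, show ‖η‖ ^ 2 = 1 + ‖ξ‖ ^ 2 by linarith]; ring
      rw [hX, him, neg_sq, neg_sq]
      exact h
    · have hb := sq_im_inner_toEuclideanLin_le (D := D) ξ η
      rw [← hM, show ‖ξ‖ ^ 2 = 1 + ‖η‖ ^ 2 by linarith, mul_comm (1 + _)] at hb
      have h := bound hb
      have hX : α * ‖ξ‖ ^ 2 - β * ‖η‖ ^ 2 - (α + β) / 2 = w * (1 + 2 * ‖η‖ ^ 2) := by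
        rw [hwdef, show ‖ξ‖ ^ 2 = 1 + ‖η‖ ^ 2 by linarith]; ring
      simp only [hX]
      exact h
  · intro h
    set x := (z.re - (α + β) / 2) / w with hx
    have hzre : z.re = (α + β) / 2 + w * x := by rw [hx]; field_simp; ring
    rw [← div_pow, ← hx] at h
    have hY : z.im ^ 2 ≤ M ^ 2 * (x ^ 2 - 1) := by
      have h1 : z.im ^ 2 / M ^ 2 ≤ x ^ 2 - 1 := by linarith
      rw [div_le_iff₀ (by positivity)] at h1
      linarith
    have hx1 : 1 ≤ |x| := by
      rw [← one_le_sq_iff_one_le_abs]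
      have : 0 ≤ z.im ^ 2 / M ^ 2 := by positivity
      linarith
    rcases le_abs.mp hx1 with hx1 | hx1
    · right
      obtain ⟨ξ, η, hξ, hη, hi⟩ := exists_im_inner_toEuclideanLin_eq (D := D) hD
        (a := (x + 1) / 2) (b := (x - 1) / 2) (Y := z.im / 2) (by linarith) (by linarith)
        (by rw [← hM]; linarith)
      refine ⟨ξ, η, by rw [hξ, hη]; ring, Complex.ext ?_ ?_⟩
      · simp only [hξ, hη, hzre, hwdef]; ring
      · simp only [hi]; ring
    · left
      obtain ⟨ξ, η, hξ, hη, hi⟩ := exists_im_inner_toEuclideanLin_eq (D := D) hD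
        (a := (-x - 1) / 2) (b := (-x + 1) / 2) (Y := -z.im / 2) (by linarith) (by linarith)
        (by rw [← hM]; linarith)
      refine ⟨ξ, η, by rw [hξ, hη]; ring, Complex.ext ?_ ?_⟩
      · simp only [hξ, hη, Complex.neg_re, hzre, hwdef]; ring
      · simp only [hi, Complex.neg_im]; ring

end Range

end KreinRange

end

/-! ### Components, curve and numerical range together -/

theorem mainTheorem6 (n r : ℕ) (hr : 0 < r) (hrn : r < n) (α β : ℝ) (hαβ : α ≠ β)
    (C : Matrix (Fin r) (Fin (n - r)) ℂ)
    (A : Matrix (Fin r ⊕ Fin (n - r)) (Fin r ⊕ Fin (n - r)) ℂ)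
    (hA : A = KreinRange.blockMatrix (α : ℂ) (β : ℂ) C C.conjTranspose) (hnd : ¬ A.IsDiag)
    (s : ℕ) (σ : Fin s → ℝ) (hσ : StrictAnti σ)
    (hσC : Set.range σ = KreinRange.nonzeroSingularValues C)
    (J : Matrix (Fin r ⊕ Fin (n - r)) (Fin r ⊕ Fin (n - r)) ℂ)
    (hJ : J = KreinRange.signatureJ r n)
    (c ω : ℂ) (hc : c = ((α : ℂ) + (β : ℂ)) / 2) (hω : ω = ((α : ℂ) - (β : ℂ)) / 2)
    (H : Fin s → Set ℂ) (hH : ∀ j, H j = KreinRange.hyperbola c ‖ω‖ (σ j)) :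
    -- the hyperbolas are non-degenerate
    (0 < ‖ω‖ ∧ ∀ j, 0 < σ j) ∧
    -- they are pairwise distinct and nested
    Function.Injective H ∧
    (∀ i j, i < j →
      KreinRange.hyperbolicDisc c ‖ω‖ (σ j) ⊂ KreinRange.hyperbolicDisc c ‖ω‖ (σ i)) ∧
    -- the components of the Kippenhahn curve
    KreinRange.kippenhahnComponents J A =
      Set.range H
      ∪ {S | S = {(α : ℂ)} ∧ (C.rank ≠ min r (n - r) ∨ n < 2 * r)}
      ∪ {S | S = {(β : ℂ)} ∧ (C.rank ≠ min r (n - r) ∨ 2 * r < n)} ∧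
    -- the Kippenhahn curve as a set of points
    KreinRange.kippenhahnCurve J A =
      (⋃ j, H j)
      ∪ {z | z = (α : ℂ) ∧ (C.rank ≠ min r (n - r) ∨ n < 2 * r)}
      ∪ {z | z = (β : ℂ) ∧ (C.rank ≠ min r (n - r) ∨ 2 * r < n)} ∧
    -- the numerical range is the hyperbolic disc bounded by the outermost hyperbola
    (∃ hs : 0 < s,
      KreinRange.kreinRange J A = KreinRange.hyperbolicDisc c ‖ω‖ (σ ⟨0, hs⟩) ∧
      frontier (KreinRange.kreinRange J A) = H ⟨0, hs⟩) := by
  subst hA hJ hc hω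
  obtain rfl : H = fun j => KreinRange.hyperbola (((α : ℂ) + β) / 2) ‖((α : ℂ) - β) / 2‖ (σ j) :=
    funext hH
  have hT : C.toEuclideanLin ≠ 0 := by
    intro h
    have hC : C = 0 := (map_eq_zero_iff _ Matrix.toEuclideanLin.injective).mp h
    refine hnd ?_
    rw [hC, KreinRange.blockMatrix, Matrix.conjTranspose_zero, Matrix.isDiag_fromBlocks_iff]
    exact ⟨Matrix.isDiag_smul_one _ _, rfl, rfl, Matrix.isDiag_smul_one _ _⟩
  have hω : 0 < ‖((α : ℂ) - β) / 2‖ := norm_pos_iff.mpr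
    (div_ne_zero (sub_ne_zero.mpr (Complex.ofReal_injective.ne hαβ)) two_ne_zero)
  have hmem : ∀ j, σ j ∈ KreinRange.nonzeroSingularValues C := fun j => hσC ▸ Set.mem_range_self j
  have hσpos : ∀ j, 0 < σ j := fun j =>
    ((KreinRange.mem_nonzeroSingularValues_iff C _).mp (hmem j)).1
  obtain ⟨j₀, hj₀⟩ : C.toEuclideanLin.singularValues 0 ∈ Set.range σ :=
    hσC ▸ ⟨(LinearMap.singularValues_zero_pos _ hT).ne', 0, rfl⟩
  have hs : 0 < s := j₀.pos
  -- the outermost hyperbola belongs to the largest singular value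
  have hσ0 : σ ⟨0, hs⟩ = C.toEuclideanLin.singularValues 0 := by
    refine le_antisymm ?_ (hj₀ ▸ hσ.antitone (Fin.mk_le_of_le_val (Nat.zero_le _)))
    obtain ⟨-, i, hi⟩ := hmem ⟨0, hs⟩
    exact hi ▸ LinearMap.singularValues_antitone _ (Nat.zero_le i)
  have hrank : (C.rank ≠ min r (n - r) ∨ n < 2 * r ↔ C.rank < r) ∧
      (C.rank ≠ min r (n - r) ∨ 2 * r < n ↔ C.rank < n - r) := by
    have h1 := C.rank_le_height
    have h2 := C.rank_le_width
    omega
  have hcomp := KreinRange.kippenhahnComponents_blockMatrix hαβ C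
  rw [← hσC, ← Set.range_comp] at hcomp
  have hrange := KreinRange.kreinRange_blockMatrix hαβ hT
  rw [← hσ0] at hrange
  simp only [hrank.1, hrank.2]
  refine ⟨⟨hω, hσpos⟩, fun i j h => hσ.injective
      (KreinRange.hyperbola_injective hω.ne' (hσpos i) (hσpos j) h),
    fun i j h => KreinRange.hyperbolicDisc_ssubset hω.ne' (hσpos j) (hσ h), hcomp, ?_, hs, hrange,
    by rw [hrange, KreinRange.frontier_hyperbolicDisc]⟩
  rw [KreinRange.kippenhahnCurve, hcomp, Set.sUnion_union, Set.sUnion_union, Set.sUnion_range]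
  have hpt : ∀ (x : ℂ) (p : Prop), ⋃₀ {S : Set ℂ | S = {x} ∧ p} = {z | z = x ∧ p} := by
    intro x p
    ext z
    simp only [Set.mem_sUnion, Set.mem_ofPred_eq]
    constructor
    · rintro ⟨S, ⟨rfl, hp⟩, hz⟩
      exact ⟨hz, hp⟩
    · rintro ⟨rfl, hp⟩
      exact ⟨{z}, ⟨rfl, hp⟩, rfl⟩
  rw [hpt, hpt]
  rfl
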